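/- Let $\delta,T>0$. Let $\omega\colon\mathbb{R}\to\mathbb{R}$ be an interaction kernel, i.e. $\omega\ge 0$, $\operatorname{supp}\omega\subseteq[0,\delta]$, $\omega$ is integrable and $\int_0^\delta\omega(h)\,dh=1$. Let $g\colon\mathbb{R}\times\mathbb{R}\to\mathbb{R}$ be a monotone numerical flux consistent with a flux $f\colon\mathbb{R}\to\mathbb{R}$, i.e. $g(a,a)=f(a)$, $g$ is nondecreasing in its first and nonincreasing in its second argument, and $|g(a_1,b_1)-g(a_2,b_2)|\le C(|a_1-a_2|+|b_1-b_2|)$ for some constant $C$. Write $\tau_h u(x,t)=u(x+h,t)$. Let $u_0\in L^1_{\mathrm{loc}}(\mathbb{R})$ and let $u\in L^\infty(\mathbb{R}\times(0,T))$ be a weak solution of the nonlocal pair-interaction model $$\frac{\partial u}{\partial t}+\int_0^\delta\frac{g(u,\tau_hu)-g(\tau_{-h}u,u)}{h}\,\omega(h)\,dh=0\quad\text{in }\mathbb{R}\times(0,T),\qquad u(\cdot,0)=u_0,$$ that is, $$\int_0^T\!\!\int_{\mathbb{R}}u\,\frac{\partial\phi}{\partial t}\,dx\,dt+\int_{\mathbb{R}}u_0(x)\phi(x,0)\,dx+\int_0^T\!\!\int_{\mathbb{R}}\int_0^\delta\frac{\tau_h\phi-\phi}{h}\,g(u,\tau_hu)\,\omega(h)\,dh\,dx\,dt=0$$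 for all $\phi\in C_c^\infty(\mathbb{R}\times[0,T))$. Let $I\subseteq[0,T]$ be an interval and let $x\colon I\to\mathbb{R}$ be such that $\Gamma=\{(x(t),t):t\in I\}$ is a rectifiable curve (i.e. $t\mapsto(x(t),t)$ is continuous and has finite length over every compact subinterval of $I$). Suppose that $u$ is piecewise $C^1$ with an isolated discontinuity along $\Gamma$: for every $t$ in the interior of $I$ the point $(x(t),t)$ has a neighbourhood $U$ such that $u$ is $C^1$ on $U\setminus\Gamma$, and the one-sided limits $u_\pm(t)=\lim_{y\to x(t)\pm0}u(y,t)$ exist and satisfy $u_-(t)\ne u_+(t)$. Then the discontinuity is stationary: $x$ is differentiable on $I$ with $x'(t)=0$ for all $t\in I$, and $x$ is constant on $I$. -/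

import Mathlib

open Set MeasureTheory Filter Topology
open scoped ContDiff ENNReal

/-- A nonlocal interaction kernel with horizon `δ`: nonnegative, supported in `[0, δ]`, and of
total mass one. -/
structure IsInteractionKernel (δ : ℝ) (w : ℝ → ℝ) : Prop where
  nonneg : ∀ h, 0 ≤ w h
  support_subset : Function.support w ⊆ Icc 0 δ
  intervalIntegrable : IntervalIntegrable w volume 0 δ
  integral_eq_one : ∫ h in (0 : ℝ)..δ, w h = 1

/-- A two-point numerical flux `g` that is consistent with the flux `f`, nondecreasing in its first
and nonincreasing in its second argument, and globally Lipschitz continuous. -/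
structure IsMonotoneFlux (f : ℝ → ℝ) (g : ℝ → ℝ → ℝ) : Prop where
  consistent : ∀ a, g a a = f a
  monotone_left : ∀ b, Monotone fun a => g a b
  antitone_right : ∀ a, Antitone fun b => g a b
  lipschitz : ∃ C : ℝ, ∀ a₁ b₁ a₂ b₂, |g a₁ b₁ - g a₂ b₂| ≤ C * (|a₁ - a₂| + |b₁ - b₂|)

/-- Test functions in `C_c^∞(ℝ × [0, T))`, points being written `(x, t)`: each of them is the
restriction to `t ≥ 0` of a smooth function on the plane with compact support in `{t < T}`. -/
structure IsTestFunction (T : ℝ) (φ : ℝ × ℝ → ℝ) : Prop where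
  contDiff : ContDiff ℝ ∞ φ
  hasCompactSupport : HasCompactSupport φ
  tsupport_subset : tsupport φ ⊆ {p | p.2 < T}

/-- `u ∈ L^∞(ℝ × (0, T))`, written as a function of `(x, t)`, is a weak solution with initial datum
`u₀` of the nonlocal pair-interaction model
`∂ₜ u + ∫_0^δ (g (u, τ_h u) - g (τ_{-h} u, u)) / h * w h dh = 0`, `u (·, 0) = u₀`,
where `τ_h u (x, t) = u (x + h, t)`. -/
structure IsWeakSolution (δ T : ℝ) (w : ℝ → ℝ) (g : ℝ → ℝ → ℝ) (u₀ : ℝ → ℝ)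
    (u : ℝ × ℝ → ℝ) : Prop where
  memLp_top : MemLp u ∞ (volume.restrict ((univ : Set ℝ) ×ˢ Ioo 0 T))
  locallyIntegrable_initial : LocallyIntegrable u₀ volume
  weak_eq : ∀ φ : ℝ × ℝ → ℝ, IsTestFunction T φ →
    (∫ t in (0 : ℝ)..T, ∫ x : ℝ, u (x, t) * deriv (fun s => φ (x, s)) t)
      + (∫ x : ℝ, u₀ x * φ (x, 0))
      + (∫ t in (0 : ℝ)..T, ∫ x : ℝ, ∫ h in (0 : ℝ)..δ,
          (φ (x + h, t) - φ (x, t)) / h * g (u (x, t)) (u (x + h, t)) * w h) = 0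

/-- The curve `{(x t, t) : t ∈ I}`. -/
def spaceTimeCurve (x : ℝ → ℝ) (I : Set ℝ) : Set (ℝ × ℝ) :=
  (fun t => (x t, t)) '' I

/-- The curve `t ↦ (x t, t)`, `t ∈ I`, is continuous and its restriction to every compact
subinterval of `I` has finite length. -/
structure IsRectifiableCurve (x : ℝ → ℝ) (I : Set ℝ) : Prop where
  continuousOn : ContinuousOn (fun t => (x t, t)) I
  locallyBoundedVariationOn : LocallyBoundedVariationOn (fun t => (x t, t)) I

/-- `u` is piecewise `C^1` near the curve `{(x t, t) : t ∈ I}` with an isolated discontinuity along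
it: every point of the curve (the end points excepted) has a neighbourhood in which `u` is `C^1`
off the curve, and at every such point the limits of `u (·, t)` from the left and from the right
exist and are different. -/
structure HasIsolatedDiscontinuityAlong (u : ℝ × ℝ → ℝ) (x : ℝ → ℝ) (I : Set ℝ) : Prop where
  contDiffOn_off_curve : ∀ t ∈ interior I,
    ∃ U ∈ 𝓝 (x t, t), ContDiffOn ℝ 1 u (U \ spaceTimeCurve x I)
  jump : ∀ t ∈ interior I, ∃ uL uR : ℝ,
    Tendsto (fun y => u (y, t)) (𝓝[<] (x t)) (𝓝 uL) ∧
    Tendsto (fun y => u (y, t)) (𝓝[>] (x t)) (𝓝 uR) ∧ uL ≠ uR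

/-!
The nonlocal term is the `x`-derivative of a bounded flux that is continuous in `x`, even across
the discontinuity of `u`; hence a moving jump could not satisfy a Rankine-Hugoniot condition. In
quantitative form: tested against a smooth window `a` of width of order `ρ`, the nonlocal term is
at most a constant times `∫ min (ρ / h) D * w h`, because `∫ |a (x + h) - a x| dx` is at most of
order `min ρ h`. This modulus tends to zero with `ρ` by dominated convergence
(`tendsto_nonlocalModulus`), even where `w h / h` is not integrable. The mass
`∫ a y * u (y, t) dy` is continuous in `t`, since a time slice of the curve is a single point, so the weak
formulation makes it Lipschitz in time with that small constant
(`IsWeakSolution.abs_mass_sub_le`).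

The curve is merely continuous and of bounded variation, possibly like a Cantor function, and the
one-sided limits of `u` are not assumed to be uniform in time. Let `K` be the closed set of times
near which `x` is not constant. If `K` meets the interior of `I`, the Baire category theorem on
`K` gives a relatively open portion of `K` on which the jump is at least some `c` and the
oscillation of `u` on either side is at most `c / 8`, up to a distance `κ` from the curve that
does not depend on the time. For two times `s`, `t` in that portion, `u (·, s)` and `u (·, t)` lie
on different sides of the jump on the interval between `x s` and `x t`, so the mass there changes
by an amount of order `c * |x t - x s|`. Comparison with the mass bound shows that `|x t - x s|`
is at most `|t - s|` times a quantity that tends to zero with `|x t - x s|`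
(`IsWeakSolution.displacement_le`). Since `x` is constant between the points of `K`, it has
derivative zero near the portion (`hasDerivAt_zero_of_displacement`), so it is constant there,
against the choice of `K`. Hence `x` is locally constant in the interior of `I`, and constant on
`I` by continuity.
-/

/-! ### The nonlocal term on thin windows -/

/-- The modulus that controls the nonlocal term tested against a window of width `4 * ρ` and
Lipschitz constant `D / ρ`. The integrand is `8 * ρ * min (1 / h) (D / ρ) * w h`: the
minimum bounds the difference quotient of the window, which vanishes off two translates of an interval of length
`4 * ρ`. -/
noncomputable def nonlocalModulus (δ : ℝ) (w : ℝ → ℝ) (D ρ : ℝ) : ℝ :=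
  ∫ h in Ioc 0 δ, 8 * (min (ρ / h) D * w h)

theorem IsInteractionKernel.integrable_Ioc {δ : ℝ} {w : ℝ → ℝ} (hδ : 0 < δ)
    (hw : IsInteractionKernel δ w) : Integrable w (volume.restrict (Ioc 0 δ)) :=
  (intervalIntegrable_iff_integrableOn_Ioc_of_le hδ.le).1 hw.intervalIntegrable

theorem nonlocalModulus_nonneg {δ : ℝ} {w : ℝ → ℝ} (hw : IsInteractionKernel δ w)
    {D ρ : ℝ} (hD : 0 ≤ D) (hρ : 0 ≤ ρ) : 0 ≤ nonlocalModulus δ w D ρ := by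
  refine setIntegral_nonneg measurableSet_Ioc fun h hh => ?_
  have h1 : 0 ≤ ρ / h := div_nonneg hρ hh.1.le
  have := hw.nonneg h
  positivity

/-- The nonlocal term does not see thin windows, even if `w h / h` is not integrable at `0`. -/
theorem tendsto_nonlocalModulus {δ : ℝ} {w : ℝ → ℝ} (hδ : 0 < δ) (hw : IsInteractionKernel δ w)
    {D : ℝ} (hD : 0 ≤ D) : Tendsto (nonlocalModulus δ w D) (𝓝[≥] 0) (𝓝 0) := by
  have hwi := hw.integrable_Ioc hδ
  suffices h : Tendsto (nonlocalModulus δ w D) (𝓝[≥] 0) (𝓝 (∫ _h in Ioc 0 δ, (0 : ℝ))) by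
    simpa using h
  refine tendsto_integral_filter_of_dominated_convergence (fun h => 8 * (D * w h)) ?_ ?_
    ((hwi.const_mul D).const_mul 8) ?_
  · refine Eventually.of_forall fun ρ => ?_
    refine AEStronglyMeasurable.const_mul (AEStronglyMeasurable.mul ?_ hwi.1) _
    exact ((measurable_const.div measurable_id).min measurable_const).aestronglyMeasurable
  · filter_upwards [self_mem_nhdsWithin] with ρ hρ
    filter_upwards [ae_restrict_mem measurableSet_Ioc] with h hh
    have h1 : 0 ≤ ρ / h := div_nonneg hρ hh.1.le
    have h2 := hw.nonneg h
    rw [Real.norm_of_nonneg (by positivity)]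
    gcongr
    exact min_le_right _ _
  · filter_upwards [ae_restrict_mem measurableSet_Ioc] with h hh
    have hc : Continuous fun ρ : ℝ => 8 * (min (ρ / h) D * w h) := by fun_prop
    have := hc.tendsto 0
    simp only [zero_div, min_eq_left hD, zero_mul, mul_zero] at this
    exact this.mono_left nhdsWithin_le_nhds

/-- A window of width `4 * ρ` about `c`: it takes values in `[0, 1]`, vanishes off
`[c - 2 * ρ, c + 2 * ρ]`, and has Lipschitz constant `D / ρ`. -/
structure IsWindow (D c ρ : ℝ) (a : ℝ → ℝ) : Prop where
  nonneg : ∀ y, 0 ≤ a y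
  le_one : ∀ y, a y ≤ 1
  eq_zero : ∀ y, y ∉ Icc (c - 2 * ρ) (c + 2 * ρ) → a y = 0
  lipschitz : ∀ y z, |a y - a z| ≤ D / ρ * |y - z|

/-- The majorant of the integrand of the nonlocal term tested against a window. -/
noncomputable def windowMajorant (w : ℝ → ℝ) (D c ρ : ℝ) (p : ℝ × ℝ) : ℝ :=
  ((Icc (c - 2 * ρ) (c + 2 * ρ)).indicator 1 p.1
    + (Icc (c - 2 * ρ) (c + 2 * ρ)).indicator 1 (p.1 + p.2)) * (min (1 / p.2) (D / ρ) * w p.2)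

theorem IsWindow.diffQuot_le {D c ρ : ℝ} {a : ℝ → ℝ} (ha : IsWindow D c ρ a)
    {w : ℝ → ℝ} (hw : ∀ h, 0 ≤ w h) (x : ℝ) {h : ℝ} (hh : 0 < h) :
    |(a (x + h) - a x) / h| * w h ≤ windowMajorant w D c ρ (x, h) := by
  unfold windowMajorant
  rw [← mul_assoc]
  refine mul_le_mul_of_nonneg_right ?_ (hw h)
  dsimp only
  have h1 : |(a (x + h) - a x) / h| ≤ min (1 / h) (D / ρ) := by
    rw [abs_div, abs_of_pos hh]
    refine le_min ?_ ?_
    · gcongr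
      rw [abs_le]
      constructor <;> linarith [ha.nonneg x, ha.nonneg (x + h), ha.le_one x, ha.le_one (x + h)]
    · rw [div_le_iff₀ hh]
      simpa [abs_of_pos hh] using ha.lipschitz (x + h) x
  have h0 : 0 ≤ min (1 / h) (D / ρ) := (abs_nonneg _).trans h1
  by_cases hx : x ∈ Icc (c - 2 * ρ) (c + 2 * ρ)
  · rw [indicator_of_mem hx]
    refine h1.trans (le_mul_of_one_le_left h0 ?_)
    simp only [Pi.one_apply, le_add_iff_nonneg_right]
    exact indicator_nonneg (fun _ _ => zero_le_one) _
  · by_cases hx' : x + h ∈ Icc (c - 2 * ρ) (c + 2 * ρ)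
    · rw [indicator_of_mem hx', indicator_of_notMem hx]
      simpa using h1
    · rw [ha.eq_zero _ hx, ha.eq_zero _ hx', indicator_of_notMem hx, indicator_of_notMem hx']
      simp

theorem windowMajorant_slice (w : ℝ → ℝ) (D c : ℝ) {ρ : ℝ} (hρ : 0 < ρ) {h : ℝ} (hh : 0 < h) :
    Integrable (fun x => windowMajorant w D c ρ (x, h)) ∧
      ∫ x, windowMajorant w D c ρ (x, h) = 8 * (min (ρ / h) D * w h) := by
  set S := Icc (c - 2 * ρ) (c + 2 * ρ)
  have hi : Integrable (S.indicator (1 : ℝ → ℝ)) :=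
    (integrable_indicator_iff measurableSet_Icc).2 (integrableOn_const (by simp))
  have hv : ∫ x, S.indicator (1 : ℝ → ℝ) x = 4 * ρ := by
    rw [integral_indicator_one measurableSet_Icc, Measure.real, Real.volume_Icc,
      ENNReal.toReal_ofReal (by linarith)]
    ring
  have hi' := hi.comp_add_right h
  simp only [windowMajorant]
  refine ⟨(hi.add hi').mul_const _, ?_⟩
  rw [integral_mul_const, integral_add hi hi', integral_add_right_eq_self, hv]
  have : min (ρ / h) D = ρ * min (1 / h) (D / ρ) := by
    rw [mul_min_of_nonneg _ _ hρ.le]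
    congr 1 <;> field_simp
  rw [this]
  ring

theorem windowMajorant_integrable {δ : ℝ} {w : ℝ → ℝ} (hδ : 0 < δ) (hw : IsInteractionKernel δ w)
    {D : ℝ} (hD : 0 ≤ D) (c : ℝ) {ρ : ℝ} (hρ : 0 < ρ) :
    Integrable (windowMajorant w D c ρ) (volume.prod (volume.restrict (Ioc 0 δ))) := by
  have hwi := hw.integrable_Ioc hδ
  have hmS : Measurable ((Icc (c - 2 * ρ) (c + 2 * ρ)).indicator (1 : ℝ → ℝ)) :=
    measurable_one.indicator measurableSet_Icc
  have hm : AEStronglyMeasurable (windowMajorant w D c ρ)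
      (volume.prod (volume.restrict (Ioc 0 δ))) := by
    refine AEStronglyMeasurable.mul ?_ (AEStronglyMeasurable.mul ?_ ?_)
    · exact ((hmS.comp measurable_fst).add
        (hmS.comp (measurable_fst.add measurable_snd))).aestronglyMeasurable
    · exact ((measurable_const.div measurable_snd).min measurable_const).aestronglyMeasurable
    · exact hwi.1.comp_snd
  rw [integrable_prod_iff' hm]
  constructor
  · filter_upwards [ae_restrict_mem measurableSet_Ioc] with h hh
    exact (windowMajorant_slice w D c hρ hh.1).1
  · have hb : Integrable (fun h => 8 * (D * w h)) (volume.restrict (Ioc 0 δ)) :=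
      (hwi.const_mul D).const_mul 8
    refine hb.mono' (AEStronglyMeasurable.integral_prod_right' hm.norm.prod_swap) ?_
    filter_upwards [ae_restrict_mem measurableSet_Ioc] with h hh
    have h1 : ∀ x, ‖windowMajorant w D c ρ (x, h)‖ = windowMajorant w D c ρ (x, h) := by
      intro x
      refine Real.norm_of_nonneg (mul_nonneg (add_nonneg ?_ ?_) (mul_nonneg (le_min ?_ ?_) ?_))
      · exact indicator_nonneg (fun _ _ => zero_le_one) _
      · exact indicator_nonneg (fun _ _ => zero_le_one) _
      · exact (one_div_pos.2 hh.1).le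
      · positivity
      · exact hw.nonneg h
    simp only [h1]
    rw [(windowMajorant_slice w D c hρ hh.1).2, Real.norm_of_nonneg]
    · have := hw.nonneg h
      gcongr
      exact min_le_right _ _
    · have := hw.nonneg h
      have : 0 ≤ ρ / h := (div_pos hρ hh.1).le
      positivity

/-- Nothing is assumed about the measurability of `v` or of the integrands: the bound holds for the
Bochner integrals as they stand. -/
theorem IsWindow.abs_nonlocal_le {δ : ℝ} {w : ℝ → ℝ} (hδ : 0 < δ) (hw : IsInteractionKernel δ w)
    {D : ℝ} (hD : 0 ≤ D) {c ρ : ℝ} (hρ : 0 < ρ) {a : ℝ → ℝ} (ha : IsWindow D c ρ a)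
    {g : ℝ → ℝ → ℝ} {M G : ℝ} (hG : ∀ p q, |p| ≤ M → |q| ≤ M → |g p q| ≤ G)
    {v : ℝ → ℝ} (hv : ∀ᵐ x, |v x| ≤ M) :
    |∫ x : ℝ, ∫ h in (0 : ℝ)..δ, (a (x + h) - a x) / h * g (v x) (v (x + h)) * w h|
      ≤ G * nonlocalModulus δ w D ρ := by
  have hK := windowMajorant_integrable hδ hw hD c hρ
  have hval : ∫ x, ∫ h in Ioc 0 δ, windowMajorant w D c ρ (x, h) = nonlocalModulus δ w D ρ := by
    rw [integral_integral_swap (f := fun x h => windowMajorant w D c ρ (x, h)) hK]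
    exact setIntegral_congr_fun measurableSet_Ioc
      fun h hh => (windowMajorant_slice w D c hρ hh.1).2
  rw [← hval, ← integral_const_mul, ← Real.norm_eq_abs]
  refine norm_integral_le_of_norm_le (hK.integral_prod_left.const_mul G) ?_
  filter_upwards [hv, hK.prod_right_ae] with x hx hKx
  rw [intervalIntegral.integral_of_le hδ.le, ← integral_const_mul]
  refine norm_integral_le_of_norm_le (hKx.const_mul G) ?_
  have hv' : ∀ᵐ h, |v (x + h)| ≤ M :=
    (measurePreserving_add_left volume x).quasiMeasurePreserving.ae hv
  filter_upwards [ae_restrict_of_ae hv', ae_restrict_mem measurableSet_Ioc] with h hvh hh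
  have h1 := hG _ _ hx hvh
  have h2 := ha.diffQuot_le hw.nonneg x hh.1
  rw [Real.norm_eq_abs, abs_mul, abs_mul, abs_of_nonneg (hw.nonneg h)]
  calc _ = |g (v x) (v (x + h))| * (|(a (x + h) - a x) / h| * w h) := by ring
    _ ≤ G * windowMajorant w D c ρ (x, h) :=
      mul_le_mul h1 h2 (mul_nonneg (abs_nonneg _) (hw.nonneg h)) ((abs_nonneg _).trans h1)

theorem IsMonotoneFlux.exists_bound {f : ℝ → ℝ} {g : ℝ → ℝ → ℝ} (hg : IsMonotoneFlux f g) (M : ℝ) :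
    ∃ G, 0 ≤ G ∧ ∀ p q, |p| ≤ M → |q| ≤ M → |g p q| ≤ G := by
  obtain ⟨C, hC⟩ := hg.lipschitz
  refine ⟨|C| * (|M| + |M|) + |g 0 0|, by positivity, fun p q hp hq => ?_⟩
  have h1 := hC p q 0 0
  rw [sub_zero, sub_zero] at h1
  have h2 : |g p q| ≤ |g p q - g 0 0| + |g 0 0| := by
    simpa using abs_add_le (g p q - g 0 0) (g 0 0)
  have h3 : C * (|p| + |q|) ≤ |C| * (|M| + |M|) := by
    refine (mul_le_mul_of_nonneg_right (le_abs_self C) (by positivity)).trans ?_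
    have := le_abs_self M
    exact mul_le_mul_of_nonneg_left (by linarith) (abs_nonneg C)
  linarith

/-- The standard smooth window, equal to `1` on `[c - ρ, c + ρ]`. -/
noncomputable def smoothWindow (c ρ y : ℝ) : ℝ :=
  (⟨1, 2, one_pos, one_lt_two⟩ : ContDiffBump (0 : ℝ)) ((y - c) / ρ)

theorem contDiff_smoothWindow (c ρ : ℝ) : ContDiff ℝ ∞ (smoothWindow c ρ) := by
  unfold smoothWindow
  exact (ContDiffBump.contDiff _).comp (by fun_prop)

/-- The Lipschitz constants of the standard windows scale like `1 / ρ`. -/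
theorem exists_isWindow_smoothWindow :
    ∃ D : ℝ, 0 ≤ D ∧ ∀ c ρ : ℝ, 0 < ρ → IsWindow D c ρ (smoothWindow c ρ) := by
  obtain ⟨C, hC⟩ := ContDiff.lipschitzWith_of_hasCompactSupport (𝕂 := ℝ) (n := 1)
    (ContDiffBump.hasCompactSupport (⟨1, 2, one_pos, one_lt_two⟩ : ContDiffBump (0 : ℝ)))
    (ContDiffBump.contDiff _) one_ne_zero
  refine ⟨C, C.2, fun c ρ hρ => ⟨fun y => ContDiffBump.nonneg _, fun y => ContDiffBump.le_one _,
    fun y hy => ?_, fun y z => ?_⟩⟩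
  · refine ContDiffBump.zero_of_le_dist _ ?_
    rw [Real.dist_eq, sub_zero, abs_div, abs_of_pos hρ, le_div_iff₀ hρ]
    by_contra! hlt
    refine hy ?_
    have := abs_lt.1 hlt
    exact ⟨by dsimp only at this; linarith, by dsimp only at this; linarith⟩
  · have := hC.dist_le_mul ((y - c) / ρ) ((z - c) / ρ)
    rw [Real.dist_eq, Real.dist_eq, ← sub_div, abs_div, abs_of_pos hρ] at this
    refine this.trans (le_of_eq ?_)
    rw [sub_sub_sub_cancel_right]
    ring

theorem smoothWindow_eq_one {c ρ y : ℝ} (hρ : 0 < ρ) (hy : y ∈ Icc (c - ρ) (c + ρ)) :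
    smoothWindow c ρ y = 1 := by
  refine ContDiffBump.one_of_mem_closedBall _ ?_
  rw [Metric.mem_closedBall, Real.dist_eq, sub_zero, abs_div, abs_of_pos hρ, div_le_iff₀ hρ,
    abs_le]
  constructor <;> dsimp only <;> linarith [hy.1, hy.2]

theorem integrable_smoothWindow {c ρ : ℝ} (hρ : 0 < ρ) : Integrable (smoothWindow c ρ) := by
  obtain ⟨D, -, hD⟩ := exists_isWindow_smoothWindow
  exact (contDiff_smoothWindow c ρ).continuous.integrable_of_hasCompactSupport
    (HasCompactSupport.intro isCompact_Icc (hD c ρ hρ).eq_zero)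

theorem two_mul_le_integral_smoothWindow {c ρ : ℝ} (hρ : 0 < ρ) :
    2 * ρ ≤ ∫ y, smoothWindow c ρ y := by
  obtain ⟨D, -, hD⟩ := exists_isWindow_smoothWindow
  have hw := hD c ρ hρ
  calc 2 * ρ = ∫ y, (Icc (c - ρ) (c + ρ)).indicator (1 : ℝ → ℝ) y := by
        rw [integral_indicator_one measurableSet_Icc, Measure.real, Real.volume_Icc,
          ENNReal.toReal_ofReal (by linarith)]
        ring
    _ ≤ ∫ y, smoothWindow c ρ y := by
        refine integral_mono ((integrable_indicator_iff measurableSet_Icc).2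
          (integrableOn_const (by simp)))
          (integrable_smoothWindow hρ) fun y => ?_
        by_cases hy : y ∈ Icc (c - ρ) (c + ρ)
        · rw [indicator_of_mem hy, smoothWindow_eq_one hρ hy, Pi.one_apply]
        · rw [indicator_of_notMem hy]
          exact hw.nonneg y

/-! ### From the weak formulation to a Lipschitz bound in time -/

/-- A smooth step that rises from `0` to `1` on `[τ, τ + ε]`. -/
noncomputable def smoothStep (τ ε t : ℝ) : ℝ :=
  Real.smoothTransition ((t - τ) / ε)

theorem contDiff_smoothStep (τ ε : ℝ) : ContDiff ℝ ∞ (smoothStep τ ε) :=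
  Real.smoothTransition.contDiff.comp (by fun_prop)

theorem smoothStep_eq_zero {τ ε t : ℝ} (hε : 0 < ε) (ht : t ≤ τ) : smoothStep τ ε t = 0 :=
  Real.smoothTransition.zero_of_nonpos (div_nonpos_of_nonpos_of_nonneg (by linarith) hε.le)

theorem smoothStep_eq_one {τ ε t : ℝ} (hε : 0 < ε) (ht : τ + ε ≤ t) : smoothStep τ ε t = 1 :=
  Real.smoothTransition.one_of_one_le ((one_le_div hε).2 (by linarith))

theorem monotone_smoothStep {τ ε : ℝ} (hε : 0 < ε) : Monotone (smoothStep τ ε) := fun s t hst =>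
  Real.smoothTransition.monotone (by gcongr)

theorem continuous_deriv_smoothStep (τ ε : ℝ) : Continuous (deriv (smoothStep τ ε)) :=
  (contDiff_smoothStep τ ε).continuous_deriv (by simp)

theorem deriv_smoothStep_eq_zero {τ ε t : ℝ} (hε : 0 < ε) (ht : t ∉ Icc τ (τ + ε)) :
    deriv (smoothStep τ ε) t = 0 := by
  rcases lt_or_ge t τ with h | h
  · have : smoothStep τ ε =ᶠ[𝓝 t] fun _ => 0 := by
      filter_upwards [Iio_mem_nhds h] with s hs using smoothStep_eq_zero hε (le_of_lt hs)
    rw [this.deriv_eq, deriv_const]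
  · have h' : τ + ε < t := not_le.1 fun h' => ht ⟨h, h'⟩
    have : smoothStep τ ε =ᶠ[𝓝 t] fun _ => 1 := by
      filter_upwards [Ioi_mem_nhds h'] with s hs using smoothStep_eq_one hε (le_of_lt hs)
    rw [this.deriv_eq, deriv_const]

theorem intervalIntegrable_deriv_smoothStep_mul (τ ε p q : ℝ) {A : ℝ → ℝ} (hA : Continuous A) :
    IntervalIntegrable (fun t => deriv (smoothStep τ ε) t * A t) volume p q :=
  ((continuous_deriv_smoothStep τ ε).mul hA).intervalIntegrable _ _

theorem abs_integral_deriv_smoothStep_mul_sub_le {T τ ε e : ℝ} {A : ℝ → ℝ} (hA : Continuous A)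
    (hε : 0 < ε) (hτ : 0 ≤ τ) (hT : τ + ε ≤ T) (he : ∀ t ∈ Icc τ (τ + ε), |A t - A τ| ≤ e) :
    |(∫ t in (0 : ℝ)..T, deriv (smoothStep τ ε) t * A t) - A τ| ≤ e := by
  have hcd := continuous_deriv_smoothStep τ ε
  have hone : ∫ t in (0 : ℝ)..T, deriv (smoothStep τ ε) t = 1 := by
    rw [intervalIntegral.integral_deriv_eq_sub
      (fun t _ => ((contDiff_smoothStep τ ε).differentiable (by simp)) t)
      (hcd.intervalIntegrable _ _), smoothStep_eq_one hε hT, smoothStep_eq_zero hε hτ, sub_zero]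
  have h1 : (∫ t in (0 : ℝ)..T, deriv (smoothStep τ ε) t * A t) - A τ
      = ∫ t in (0 : ℝ)..T, deriv (smoothStep τ ε) t * (A t - A τ) := by
    simp only [mul_sub]
    rw [intervalIntegral.integral_sub (intervalIntegrable_deriv_smoothStep_mul _ _ _ _ hA)
      (intervalIntegrable_deriv_smoothStep_mul _ _ _ _ continuous_const),
      intervalIntegral.integral_mul_const, hone, one_mul]
  have h2 : ∫ t in (0 : ℝ)..T, deriv (smoothStep τ ε) t * e = e := by
    rw [intervalIntegral.integral_mul_const, hone, one_mul]
  rw [h1, ← Real.norm_eq_abs]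
  refine le_of_le_of_eq ?_ h2
  refine intervalIntegral.norm_integral_le_of_norm_le (by linarith) ?_
    (intervalIntegrable_deriv_smoothStep_mul _ _ _ _ continuous_const)
  refine Eventually.of_forall fun t _ => ?_
  by_cases ht : t ∈ Icc τ (τ + ε)
  · have h0 : 0 ≤ deriv (smoothStep τ ε) t := (monotone_smoothStep hε).deriv_nonneg
    rw [norm_mul, Real.norm_of_nonneg h0]
    exact mul_le_mul_of_nonneg_left (he t ht) h0
  · simp [deriv_smoothStep_eq_zero hε ht]

/-- A function whose distributional derivative is bounded by `L` is Lipschitz where it is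
continuous. -/
theorem abs_sub_le_of_weak_deriv {T L t₁ t₂ β : ℝ} {A : ℝ → ℝ} (h0 : 0 < t₁) (h12 : t₁ < t₂)
    (h2β : t₂ < β) (hβ : β < T) (hA : ContinuousOn A (Icc t₁ β))
    (h : ∀ (b : ℝ → ℝ) (p q : ℝ), 0 < p → p ≤ q → q < T → ContDiff ℝ ∞ b →
      (∀ t ∉ Icc p q, b t = 0) → (∀ t, |b t| ≤ 1) →
      |∫ t in (0 : ℝ)..T, deriv b t * A t| ≤ L * (q - p)) :
    |A t₂ - A t₁| ≤ L * (t₂ - t₁) := by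
  -- A continuous extension of `A` off `[t₁, β]`, where the derivatives of the steps vanish.
  have hB : Continuous (IccExtend (h12.trans h2β).le ((Icc t₁ β).domRestrict A)) :=
    (continuousOn_iff_continuous_domRestrict.1 hA).Icc_extend'
  set B := IccExtend (h12.trans h2β).le ((Icc t₁ β).domRestrict A)
  have hAB : ∀ t ∈ Icc t₁ β, B t = A t := fun t ht => by
    rw [show B t = _ from IccExtend_of_mem _ _ ht]; rfl
  rw [← hAB t₁ ⟨le_rfl, (h12.trans h2β).le⟩, ← hAB t₂ ⟨h12.le, h2β.le⟩]
  refine le_of_forall_pos_le_add fun e he => ?_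
  have hcont : ∀ τ, ∀ᶠ ε in 𝓝[>] (0 : ℝ), ∀ t ∈ Icc τ (τ + ε), |B t - B τ| ≤ e / 3 := by
    intro τ
    obtain ⟨d, hd, hd'⟩ := Metric.continuousAt_iff.1 hB.continuousAt (e / 3) (by positivity)
    filter_upwards [Ioo_mem_nhdsGT hd] with ε hε t ht
    refine (hd' ?_).le
    rw [Real.dist_eq, abs_of_nonneg] <;> linarith [ht.1, ht.2, hε.2]
  have hL : ∀ᶠ ε in 𝓝[>] (0 : ℝ), L * ε < e / 3 := by
    have : Continuous fun ε : ℝ => L * ε := by fun_prop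
    refine (this.tendsto 0).eventually_lt_const (by simpa using by positivity)
      |>.filter_mono nhdsWithin_le_nhds
  obtain ⟨ε, ⟨h1, h2, hLε, hεβ⟩, hε⟩ := ((hcont t₁).and ((hcont t₂).and (hL.and
    (Ioo_mem_nhdsGT (show (0 : ℝ) < β - t₂ by linarith))))).and self_mem_nhdsWithin |>.exists
  replace hε : 0 < ε := hε
  have hεβ' := hεβ.2
  have e1 := abs_integral_deriv_smoothStep_mul_sub_le hB hε h0.le (T := T) (by linarith) h1
  have e2 := abs_integral_deriv_smoothStep_mul_sub_le hB hε (h0.trans h12).le (T := T)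
    (by linarith) h2
  have hd : ∀ t, deriv (fun t => smoothStep t₁ ε t - smoothStep t₂ ε t) t
      = deriv (smoothStep t₁ ε) t - deriv (smoothStep t₂ ε) t := fun t =>
    deriv_fun_sub (((contDiff_smoothStep _ _).differentiable (by simp)) t)
      (((contDiff_smoothStep _ _).differentiable (by simp)) t)
  have e3 := h (fun t => smoothStep t₁ ε t - smoothStep t₂ ε t) t₁ (t₂ + ε) h0 (by linarith)
    (by linarith) ((contDiff_smoothStep _ _).sub (contDiff_smoothStep _ _)) ?_ ?_
  · have e4 : (∫ t in (0 : ℝ)..T, deriv (fun t => smoothStep t₁ ε t - smoothStep t₂ ε t) t * A t)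
        = (∫ t in (0 : ℝ)..T, deriv (smoothStep t₁ ε) t * B t)
          - ∫ t in (0 : ℝ)..T, deriv (smoothStep t₂ ε) t * B t := by
      rw [← intervalIntegral.integral_sub
        (intervalIntegrable_deriv_smoothStep_mul _ _ _ _ hB)
        (intervalIntegrable_deriv_smoothStep_mul _ _ _ _ hB)]
      refine intervalIntegral.integral_congr fun t _ => ?_
      rw [hd, ← sub_mul]
      by_cases ht : t ∈ Icc t₁ β
      · rw [hAB t ht]
      · rw [deriv_smoothStep_eq_zero hε fun h' => ht ⟨h'.1, by linarith [h'.2]⟩,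
          deriv_smoothStep_eq_zero hε fun h' => ht ⟨by linarith [h'.1], by linarith [h'.2]⟩]
        simp
    rw [e4] at e3
    have : L * (t₂ + ε - t₁) = L * (t₂ - t₁) + L * ε := by ring
    rw [abs_le] at *
    constructor <;> linarith [e1.1, e1.2, e2.1, e2.2, e3.1, e3.2]
  · intro t ht
    rcases lt_or_ge t t₁ with h' | h'
    · rw [smoothStep_eq_zero hε h'.le, smoothStep_eq_zero hε (h'.trans h12).le, sub_zero]
    · have : t₂ + ε < t := not_le.1 fun h'' => ht ⟨h', h''⟩
      rw [smoothStep_eq_one hε (by linarith), smoothStep_eq_one hε this.le, sub_self]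
  · intro t
    unfold smoothStep
    rw [abs_le]
    constructor <;> linarith [Real.smoothTransition.nonneg ((t - t₁) / ε),
      Real.smoothTransition.nonneg ((t - t₂) / ε), Real.smoothTransition.le_one ((t - t₁) / ε),
      Real.smoothTransition.le_one ((t - t₂) / ε)]

/-! ### Mass balance near a discontinuity -/

theorem exists_ae_abs_le {T : ℝ} {u : ℝ × ℝ → ℝ}
    (hu : MemLp u ∞ (volume.restrict ((univ : Set ℝ) ×ˢ Ioo 0 T))) :
    ∃ M, ∀ᵐ p : ℝ × ℝ, p.2 ∈ Ioo 0 T → |u p| ≤ M := by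
  refine ⟨(eLpNormEssSup u (volume.restrict ((univ : Set ℝ) ×ˢ Ioo 0 T))).toReal, ?_⟩
  have hfin : eLpNormEssSup u (volume.restrict ((univ : Set ℝ) ×ˢ Ioo 0 T)) ≠ ⊤ := by
    rw [← eLpNorm_exponent_top]
    exact hu.2.ne
  have h1 := ae_le_eLpNormEssSup (f := u) (μ := volume.restrict ((univ : Set ℝ) ×ˢ Ioo 0 T))
  rw [ae_restrict_iff' (MeasurableSet.univ.prod measurableSet_Ioo)] at h1
  filter_upwards [h1] with p hp hpT
  have h2 := hp ⟨mem_univ _, hpT⟩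
  rw [← Real.norm_eq_abs, ← toReal_enorm]
  exact ENNReal.toReal_mono hfin h2

theorem ae_ae_abs_le {T M : ℝ} {u : ℝ × ℝ → ℝ}
    (hM : ∀ᵐ p : ℝ × ℝ, p.2 ∈ Ioo 0 T → |u p| ≤ M) :
    ∀ᵐ t : ℝ, t ∈ Ioo 0 T → ∀ᵐ x : ℝ, |u (x, t)| ≤ M := by
  have h1 : ∀ᵐ q : ℝ × ℝ, q.1 ∈ Ioo 0 T → |u q.swap| ≤ M :=
    (Measure.measurePreserving_swap (μ := (volume : Measure ℝ))
      (ν := (volume : Measure ℝ))).quasiMeasurePreserving.ae hM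
  filter_upwards [Measure.ae_ae_of_ae_prod h1] with t ht htT
  filter_upwards [ht] with x hx using hx htT

/-- An almost everywhere bound holds at every point of continuity. -/
theorem abs_le_of_continuousAt {T M : ℝ} {u : ℝ × ℝ → ℝ}
    (hM : ∀ᵐ p : ℝ × ℝ, p.2 ∈ Ioo 0 T → |u p| ≤ M) {p : ℝ × ℝ} (hp : p.2 ∈ Ioo 0 T)
    (hc : ContinuousAt u p) : |u p| ≤ M := by
  by_contra! hlt
  have h1 : ∀ᶠ q in 𝓝 p, M < |u q| := hc.abs.eventually_const_lt hlt
  have h2 : ∀ᶠ q : ℝ × ℝ in 𝓝 p, q.2 ∈ Ioo 0 T :=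
    continuousAt_snd.eventually (Ioo_mem_nhds hp.1 hp.2)
  obtain ⟨q, hq, hq'⟩ := ((Measure.dense_of_ae hM) p |> mem_closure_iff_nhds.1) _ (h1.and h2)
  exact absurd (hq' hq.2) (not_le.2 hq.1)

/-- The weak formulation for a test function `a x * b t` supported in `0 < t < T`. -/
theorem IsWeakSolution.tensor {δ T : ℝ} {w : ℝ → ℝ} {g : ℝ → ℝ → ℝ} {u₀ : ℝ → ℝ}
    {u : ℝ × ℝ → ℝ} (hu : IsWeakSolution δ T w g u₀ u) {a b : ℝ → ℝ} (ha : ContDiff ℝ ∞ a)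
    {l r : ℝ} (ha0 : ∀ y ∉ Icc l r, a y = 0) (hb : ContDiff ℝ ∞ b) {p q : ℝ} (hp : 0 < p)
    (hq : q < T) (hb0 : ∀ t ∉ Icc p q, b t = 0) :
    ∫ t in (0 : ℝ)..T, deriv b t * ∫ x : ℝ, a x * u (x, t)
      = -∫ t in (0 : ℝ)..T, b t * ∫ x : ℝ, ∫ h in (0 : ℝ)..δ,
          (a (x + h) - a x) / h * g (u (x, t)) (u (x + h, t)) * w h := by
  have hsub : Function.support (fun z : ℝ × ℝ => a z.1 * b z.2) ⊆ Icc l r ×ˢ Icc p q := by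
    intro z hz
    by_contra hz'
    refine hz ?_
    rw [mem_prod, not_and_or] at hz'
    rcases hz' with h | h
    · simp [ha0 _ h]
    · simp [hb0 _ h]
  have htest : IsTestFunction T (fun z : ℝ × ℝ => a z.1 * b z.2) := by
    refine ⟨(ha.comp contDiff_fst).mul (hb.comp contDiff_snd),
      HasCompactSupport.of_support_subset_isCompact (isCompact_Icc.prod isCompact_Icc) hsub, ?_⟩
    refine (closure_minimal hsub (isClosed_Icc.prod isClosed_Icc)).trans fun z hz => ?_
    exact hz.2.2.trans_lt hq
  have h := hu.weak_eq _ htest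
  have hb00 : b 0 = 0 := hb0 0 fun h' => absurd h'.1 (not_le.2 hp)
  simp only [hb00, mul_zero, integral_zero, add_zero] at h
  rw [eq_neg_iff_add_eq_zero]
  refine Eq.trans ?_ h
  congr 1
  · refine intervalIntegral.integral_congr fun t _ => ?_
    rw [← integral_const_mul]
    congr 1 with x
    rw [deriv_const_mul_field]
    ring
  · refine intervalIntegral.integral_congr fun t _ => ?_
    rw [← integral_const_mul]
    congr 1 with x
    rw [← intervalIntegral.integral_const_mul]
    congr 1 with h
    ring

/-- The mean of `u (·, t)` against a fixed window is continuous in `t`, although `u` may jump along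
a curve: each time slice of the curve is a single point. -/
theorem continuousAt_integral_mul {u : ℝ × ℝ → ℝ} {x a : ℝ → ℝ} {l r M t₀ : ℝ}
    (ha : Continuous a) (ha0 : ∀ y ∉ Ioo l r, a y = 0) (ha1 : ∀ y, |a y| ≤ 1)
    (hu : ∀ᶠ t in 𝓝 t₀, ∀ y ∈ Ioo l r, y ≠ x t → ContinuousAt u (y, t) ∧ |u (y, t)| ≤ M) :
    ContinuousAt (fun t => ∫ y, a y * u (y, t)) t₀ := by
  have hslice : ∀ t y, ContinuousAt u (y, t) → ContinuousAt (fun y => u (y, t)) y := fun t y h =>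
    h.comp (f := fun y => (y, t)) (by fun_prop)
  have hne : ∀ t, ∀ᵐ y : ℝ, y ≠ x t := fun t => by
    simp [ae_iff]
  refine continuousAt_of_dominated (bound := (Ioo l r).indicator fun _ => M) ?_ ?_ ?_ ?_
  · filter_upwards [hu] with t ht
    have hms : MeasurableSet (Ioo l r \ {x t}) := measurableSet_Ioo.diff (measurableSet_singleton _)
    have h1 : AEStronglyMeasurable ((Ioo l r \ {x t}).indicator fun y => a y * u (y, t)) := by
      rw [aestronglyMeasurable_indicator_iff hms]
      refine ContinuousOn.aestronglyMeasurable (fun y hy => ?_) hms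
      exact (ha.continuousAt.mul (hslice t y (ht y hy.1 hy.2).1)).continuousWithinAt
    refine h1.congr ?_
    filter_upwards [hne t] with y hy
    by_cases hyI : y ∈ Ioo l r
    · rw [indicator_of_mem (show y ∈ Ioo l r \ {x t} from ⟨hyI, hy⟩)]
    · rw [indicator_of_notMem fun h => hyI h.1, ha0 y hyI, zero_mul]
  · filter_upwards [hu] with t ht
    filter_upwards [hne t] with y hy
    by_cases hyI : y ∈ Ioo l r
    · rw [indicator_of_mem hyI, norm_mul]
      exact (mul_le_of_le_one_left (norm_nonneg _) (ha1 y)).trans (ht y hyI hy).2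
    · rw [indicator_of_notMem hyI, ha0 y hyI, zero_mul, norm_zero]
  · exact (integrable_indicator_iff measurableSet_Ioo).2 (integrableOn_const (by simp))
  · filter_upwards [hne t₀] with y hy
    by_cases hyI : y ∈ Ioo l r
    · refine continuousAt_const.mul ?_
      exact (hu.self_of_nhds y hyI hy).1.comp (f := fun t => (y, t)) (by fun_prop)
    · simp only [ha0 y hyI, zero_mul]
      exact continuousAt_const

/-- The mass in a window of width `4 * ρ` that meets `u` only near the curve changes at a rate that
tends to zero with `ρ`. -/
theorem IsWeakSolution.abs_mass_sub_le {δ T : ℝ} {w : ℝ → ℝ} {g : ℝ → ℝ → ℝ} {u₀ : ℝ → ℝ}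
    {u : ℝ × ℝ → ℝ} (hδ : 0 < δ) (hw : IsInteractionKernel δ w)
    (hu : IsWeakSolution δ T w g u₀ u) {M G : ℝ}
    (hM : ∀ᵐ p : ℝ × ℝ, p.2 ∈ Ioo 0 T → |u p| ≤ M)
    (hG : ∀ p q, |p| ≤ M → |q| ≤ M → |g p q| ≤ G) {x : ℝ → ℝ} {l r α β : ℝ}
    (hα : 0 ≤ α) (hβ : β ≤ T)
    (hc : ∀ y ∈ Ioo l r, ∀ t ∈ Ioo α β, y ≠ x t → ContinuousAt u (y, t))
    {D c ρ : ℝ} (hD : 0 ≤ D) (hρ : 0 < ρ) (hwin : IsWindow D c ρ (smoothWindow c ρ))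
    (hl : l < c - 2 * ρ) (hr : c + 2 * ρ < r) {t₁ t₂ : ℝ} (h1 : t₁ ∈ Ioo α β) (h2 : t₂ ∈ Ioo α β)
    (h12 : t₁ < t₂) :
    |(∫ y, smoothWindow c ρ y * u (y, t₂)) - ∫ y, smoothWindow c ρ y * u (y, t₁)|
      ≤ G * nonlocalModulus δ w D ρ * (t₂ - t₁) := by
  obtain ⟨β', hβ'⟩ := exists_between h2.2
  refine abs_sub_le_of_weak_deriv (A := fun t => ∫ y, smoothWindow c ρ y * u (y, t))
    (hα.trans_lt h1.1) h12 hβ'.1 (hβ'.2.trans_le hβ) ?_ ?_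
  · intro t ht
    have ht' : t ∈ Ioo α β := ⟨h1.1.trans_le ht.1, ht.2.trans_lt hβ'.2⟩
    refine (continuousAt_integral_mul (x := x) (l := l) (r := r) (M := M)
      (contDiff_smoothWindow c ρ).continuous
      (fun y hy => hwin.eq_zero y fun h => hy ⟨hl.trans_le h.1, h.2.trans_lt hr⟩)
      (fun y => ?_) ?_).continuousWithinAt
    · rw [abs_of_nonneg (hwin.nonneg y)]
      exact hwin.le_one y
    · filter_upwards [Ioo_mem_nhds ht'.1 ht'.2] with s hs y hy hne
      have := hc y hy s hs hne
      exact ⟨this, abs_le_of_continuousAt hM ⟨hα.trans_lt hs.1, hs.2.trans_le hβ⟩ this⟩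
  · intro b p q hp hpq hq hb hb0 hb1
    rw [hu.tensor (contDiff_smoothWindow c ρ) hwin.eq_zero hb hp hq hb0, abs_neg,
      ← Real.norm_eq_abs]
    set L := G * nonlocalModulus δ w D ρ
    have hT : 0 ≤ T := by linarith
    have hsub : Icc p q ⊆ Ioc 0 T := fun t ht => ⟨hp.trans_le ht.1, ht.2.trans hq.le⟩
    have hval : ∫ t in (0 : ℝ)..T, (Icc p q).indicator (fun _ => L) t = L * (q - p) := by
      rw [intervalIntegral.integral_of_le hT, integral_indicator measurableSet_Icc,
        Measure.restrict_restrict measurableSet_Icc, inter_eq_left.2 hsub, setIntegral_const,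
        Measure.real, Real.volume_Icc, ENNReal.toReal_ofReal (by linarith), smul_eq_mul, mul_comm]
    rw [← hval]
    refine intervalIntegral.norm_integral_le_of_norm_le hT ?_ ?_
    · have hTne : ∀ᵐ t : ℝ, t ≠ T := by simp [ae_iff]
      filter_upwards [ae_ae_abs_le hM, hTne] with t ht htT htI
      have h3 := hwin.abs_nonlocal_le hδ hw hD hρ hG (ht ⟨htI.1, htI.2.lt_of_ne htT⟩)
      by_cases htpq : t ∈ Icc p q
      · rw [indicator_of_mem htpq, norm_mul]
        exact (mul_le_of_le_one_left (norm_nonneg _) (hb1 t)).trans h3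
      · rw [indicator_of_notMem htpq, hb0 t htpq, zero_mul, norm_zero]
    · rw [intervalIntegrable_iff]
      exact ((integrable_indicator_iff measurableSet_Icc).2
        (integrableOn_const (by simp))).integrableOn

/-! ### Curves that move only on a closed set of times -/

/-- The times near which `x` is not constant. -/
def movingTimes (x : ℝ → ℝ) : Set ℝ :=
  {t | ¬ ∀ᶠ s in 𝓝 t, x s = x t}

theorem isClosed_movingTimes (x : ℝ → ℝ) : IsClosed (movingTimes x) := by
  rw [← isOpen_compl_iff, isOpen_iff_mem_nhds]
  intro t ht
  have ht' : ∀ᶠ s in 𝓝 t, x s = x t := not_not.1 ht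
  filter_upwards [ht'.eventually_nhds, ht'] with s hs hst
  refine not_not.2 ?_
  filter_upwards [hs] with r hr
  rw [hr, hst]

theorem hasDerivAt_zero_of_notMem_movingTimes {x : ℝ → ℝ} {t : ℝ} (ht : t ∉ movingTimes x) :
    HasDerivAt x 0 t :=
  (hasDerivAt_const t (x t)).congr_of_eventuallyEq (not_not.1 ht)

theorem eq_of_hasDerivAt_zero {x : ℝ → ℝ} {s t : ℝ} (hx : ContinuousOn x (uIcc s t))
    (hd : ∀ r ∈ Ioo (min s t) (max s t), HasDerivAt x 0 r) : x s = x t := by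
  wlog hst : s < t generalizing s t
  · rcases (not_lt.1 hst).eq_or_lt with h | h
    · rw [h]
    · exact (this (uIcc_comm s t ▸ hx) (by rwa [min_comm, max_comm]) h).symm
  rw [uIcc_of_le hst.le] at hx
  rw [min_eq_left hst.le, max_eq_right hst.le] at hd
  obtain ⟨r, -, hr⟩ := exists_hasDerivAt_eq_slope x (fun _ => 0) hst hx hd
  have := (div_eq_zero_iff.1 hr.symm).resolve_right (by linarith)
  linarith

/-- Between moving times the curve stands still, so its position at any time `s` is already taken
at a moving time between `s` and a given moving time `t`. -/
theorem exists_movingTime_eq {x : ℝ → ℝ} {s t : ℝ} (hx : ContinuousOn x (uIcc s t))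
    (ht : t ∈ movingTimes x) : ∃ r ∈ movingTimes x ∩ uIcc s t, x r = x s := by
  have hcomp : IsCompact (movingTimes x ∩ uIcc s t) :=
    isCompact_uIcc.inter_left (isClosed_movingTimes x)
  obtain ⟨r, hr, hmin⟩ := hcomp.exists_isMinOn ⟨t, ht, right_mem_uIcc⟩
    (f := fun r => |r - s|) (by fun_prop)
  refine ⟨r, hr, eq_of_hasDerivAt_zero (hx.mono ?_) fun q hq => ?_⟩
  · exact uIcc_subset_uIcc hr.2 left_mem_uIcc
  · refine hasDerivAt_zero_of_notMem_movingTimes fun hqK => ?_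
    have hq' : q ∈ uIcc s t :=
      uIcc_subset_uIcc hr.2 left_mem_uIcc ⟨hq.1.le, hq.2.le⟩
    have h1 : |r - s| ≤ |q - s| := hmin ⟨hqK, hq'⟩
    rcases le_total r s with h | h
    · rw [min_eq_left h, max_eq_right h] at hq
      rw [abs_of_nonpos (by linarith), abs_of_nonpos (by linarith [hq.2])] at h1
      linarith [hq.1]
    · rw [min_eq_right h, max_eq_left h] at hq
      rw [abs_of_nonneg (by linarith), abs_of_nonneg (by linarith [hq.1])] at h1
      linarith [hq.2]

/-- If the displacement between moving times is small compared to the elapsed time, then the curve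
has zero speed at all times. -/
theorem hasDerivAt_zero_of_displacement {x N : ℝ → ℝ} {α β : ℝ} (hx : ContinuousOn x (Ioo α β))
    (hN : Tendsto N (𝓝[≥] 0) (𝓝 0))
    (h : ∀ s ∈ movingTimes x ∩ Ioo α β, ∀ t ∈ movingTimes x ∩ Ioo α β,
      |x t - x s| ≤ N |x t - x s| * |t - s|) {t : ℝ} (ht : t ∈ Ioo α β) : HasDerivAt x 0 t := by
  by_cases htK : t ∈ movingTimes x
  swap
  · exact hasDerivAt_zero_of_notMem_movingTimes htK
  have hxt : ContinuousAt x t := hx.continuousAt (Ioo_mem_nhds ht.1 ht.2)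
  have h0 : Tendsto (fun s => |x t - x s|) (𝓝 t) (𝓝[≥] 0) := by
    refine tendsto_nhdsWithin_iff.2 ⟨?_, Eventually.of_forall fun s => mem_Ici.2 (abs_nonneg _)⟩
    have : ContinuousAt (fun s => |x t - x s|) t := (continuousAt_const.sub hxt).abs
    simpa [ContinuousAt] using this
  rw [hasDerivAt_iff_isLittleO]
  refine Asymptotics.isLittleO_iff.2 fun e he => ?_
  filter_upwards [(hN.comp h0).eventually_le_const he, Ioo_mem_nhds ht.1 ht.2] with s hs hsI
  have hsub : uIcc s t ⊆ Ioo α β := ordConnected_Ioo.uIcc_subset hsI ht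
  obtain ⟨r, hr, hrs⟩ := exists_movingTime_eq (hx.mono hsub) htK
  have h1 := h r ⟨hr.1, hsub hr.2⟩ t ⟨htK, ht⟩
  rw [hrs] at h1
  have h2 : |t - r| ≤ |t - s| :=
    abs_sub_right_of_mem_uIcc hr.2
  rw [smul_zero, sub_zero, Real.norm_eq_abs, Real.norm_eq_abs, abs_sub_comm (x s), abs_sub_comm s]
  calc _ ≤ N |x t - x s| * |t - r| := h1
    _ ≤ e * |t - r| := mul_le_mul_of_nonneg_right hs (abs_nonneg _)
    _ ≤ e * |t - s| := mul_le_mul_of_nonneg_left h2 he.le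

/-! ### Uniform jumps on a portion of the moving times -/

/-- At time `t` the function `u` jumps across `x t` by at least `c`, with oscillation at most
`c / 8` on either side, up to distance `κ` from `x t`. -/
def IsUniformJump (u : ℝ × ℝ → ℝ) (x : ℝ → ℝ) (κ c t : ℝ) : Prop :=
  ∀ y ∈ Ioo (x t - κ) (x t), ∀ y' ∈ Ioo (x t - κ) (x t),
    ∀ z ∈ Ioo (x t) (x t + κ), ∀ z' ∈ Ioo (x t) (x t + κ),
      |u (y, t) - u (y', t)| ≤ c / 8 ∧ |u (z, t) - u (z', t)| ≤ c / 8 ∧ c ≤ |u (z, t) - u (y, t)|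

theorem exists_isUniformJump {u : ℝ × ℝ → ℝ} {x : ℝ → ℝ} {t uL uR κ : ℝ} (hκ : 0 < κ)
    (hL : Tendsto (fun y => u (y, t)) (𝓝[<] (x t)) (𝓝 uL))
    (hR : Tendsto (fun y => u (y, t)) (𝓝[>] (x t)) (𝓝 uR)) (hne : uL ≠ uR) :
    ∃ n k : ℕ, IsUniformJump u x (κ / (k + 1)) (1 / (n + 1)) t := by
  have hc0 : 0 < |uR - uL| := abs_pos.2 (sub_ne_zero.2 hne.symm)
  obtain ⟨n, hn⟩ := exists_nat_one_div_lt (half_pos hc0)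
  refine ⟨n, ?_⟩
  set c : ℝ := 1 / (n + 1)
  have hc : 0 < c := Nat.one_div_pos_of_nat
  have h1 := Metric.tendsto_nhds.1 hL (c / 16) (by positivity)
  have h2 := Metric.tendsto_nhds.1 hR (c / 16) (by positivity)
  obtain ⟨l, hl, hl'⟩ := mem_nhdsLT_iff_exists_Ioo_subset.1 h1
  obtain ⟨r, hr, hr'⟩ := mem_nhdsGT_iff_exists_Ioo_subset.1 h2
  rw [mem_Iio] at hl
  rw [mem_Ioi] at hr
  obtain ⟨k, hk⟩ := exists_nat_one_div_lt
    (div_pos (lt_min (sub_pos.2 hl) (sub_pos.2 hr)) hκ)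
  have hk' : κ / (k + 1) < min (x t - l) (r - x t) := by
    rw [lt_div_iff₀ hκ] at hk
    calc κ / (k + 1) = 1 / ((k : ℝ) + 1) * κ := by ring
      _ < _ := hk
  have hkl := hk'.trans_le (min_le_left _ _)
  have hkr := hk'.trans_le (min_le_right _ _)
  have key1 : ∀ y ∈ Ioo (x t - κ / (k + 1)) (x t), |u (y, t) - uL| < c / 16 := fun y hy =>
    hl' ⟨by linarith [hy.1], hy.2⟩
  have key2 : ∀ y ∈ Ioo (x t) (x t + κ / (k + 1)), |u (y, t) - uR| < c / 16 := fun y hy =>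
    hr' ⟨hy.1, by linarith [hy.2]⟩
  refine ⟨k, fun y hy y' hy' z hz z' hz' => ?_⟩
  have a1 := abs_lt.1 (key1 y hy)
  have a2 := abs_lt.1 (key1 y' hy')
  have a3 := abs_lt.1 (key2 z hz)
  have a4 := abs_lt.1 (key2 z' hz')
  refine ⟨abs_le.2 ⟨by linarith, by linarith⟩, abs_le.2 ⟨by linarith, by linarith⟩, ?_⟩
  rcases le_abs.1 (le_refl |uR - uL|) with h | h
  · exact le_abs.2 (Or.inl (by linarith))
  · exact le_abs.2 (Or.inr (by linarith))

theorem isClosed_isUniformJump {u : ℝ × ℝ → ℝ} {x : ℝ → ℝ} {S : Set ℝ} {κ c : ℝ}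
    (hx : ∀ s ∈ S, ContinuousAt x s)
    (hu : ∀ s ∈ S, ∀ y ∈ Ioo (x s - κ) (x s + κ), y ≠ x s → ContinuousAt u (y, s)) :
    IsClosed {s : S | IsUniformJump u x κ c s} := by
  rw [isClosed_iff_frequently]
  intro s hs y hy y' hy' z hz z' hz'
  have hxs : Tendsto (fun r : S => x r) (𝓝 s) (𝓝 (x s)) :=
    (hx s s.2).tendsto.comp continuousAt_subtype_val
  have hev : ∀ᶠ r : S in 𝓝 s, (y ∈ Ioo (x r - κ) (x r) ∧ y' ∈ Ioo (x r - κ) (x r)) ∧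
      z ∈ Ioo (x r) (x r + κ) ∧ z' ∈ Ioo (x r) (x r + κ) := by
    have hL : ∀ a ∈ Ioo (x s - κ) (x s), ∀ᶠ r : S in 𝓝 s, a ∈ Ioo (x r - κ) (x r) :=
      fun a ha => ((hxs.sub_const κ).eventually_lt_const ha.1).and (hxs.eventually_const_lt ha.2)
    have hR : ∀ a ∈ Ioo (x s) (x s + κ), ∀ᶠ r : S in 𝓝 s, a ∈ Ioo (x r) (x r + κ) :=
      fun a ha => (hxs.eventually_lt_const ha.1).and ((hxs.add_const κ).eventually_const_lt ha.2)
    exact ((hL y hy).and (hL y' hy')).and ((hR z hz).and (hR z' hz'))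
  have hfreq := hs.and_eventually hev
  have hκ : 0 < κ := by linarith [hy.1, hy.2]
  have hcont : ∀ a ∈ Ioo (x s - κ) (x s + κ), a ≠ x s →
      Tendsto (fun r : S => u (a, r)) (𝓝 s) (𝓝 (u (a, s))) := fun a ha hne =>
    (hu s s.2 a ha hne).tendsto.comp
      (Continuous.tendsto (f := fun r : S => (a, (r : ℝ))) (by fun_prop) s)
  have cy := hcont y ⟨hy.1, by linarith [hy.2]⟩ hy.2.ne
  have cy' := hcont y' ⟨hy'.1, by linarith [hy'.2]⟩ hy'.2.ne
  have cz := hcont z ⟨by linarith [hz.1], hz.2⟩ hz.1.ne'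
  have cz' := hcont z' ⟨by linarith [hz'.1], hz'.2⟩ hz'.1.ne'
  have hineq := hfreq.mono fun r hr =>
    hr.1 y hr.2.1.1 y' hr.2.1.2 z hr.2.2.1 z' hr.2.2.2
  exact ⟨le_of_tendsto_of_frequently (cy.sub cy').abs (hineq.mono fun r h => h.1),
    le_of_tendsto_of_frequently (cz.sub cz').abs (hineq.mono fun r h => h.2.1),
    ge_of_tendsto_of_frequently (cz.sub cy).abs (hineq.mono fun r h => h.2.2)⟩

/-- If the jumps are uniform at two times at which the curve is at different places, then the mass
between these places has changed by an amount comparable to the displacement; so the displacement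
is small compared to the elapsed time. -/
theorem IsWeakSolution.displacement_le {δ T : ℝ} {w : ℝ → ℝ} {g : ℝ → ℝ → ℝ} {u₀ : ℝ → ℝ}
    {u : ℝ × ℝ → ℝ} (hδ : 0 < δ) (hw : IsInteractionKernel δ w)
    (hu : IsWeakSolution δ T w g u₀ u) {M G : ℝ}
    (hM : ∀ᵐ p : ℝ × ℝ, p.2 ∈ Ioo 0 T → |u p| ≤ M) (hG0 : 0 ≤ G)
    (hG : ∀ p q, |p| ≤ M → |q| ≤ M → |g p q| ≤ G) {x : ℝ → ℝ} {l r α β : ℝ}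
    (hα : 0 ≤ α) (hβ : β ≤ T)
    (hc : ∀ y ∈ Ioo l r, ∀ t ∈ Ioo α β, y ≠ x t → ContinuousAt u (y, t))
    {D : ℝ} (hD : 0 ≤ D) (hwin : ∀ c ρ : ℝ, 0 < ρ → IsWindow D c ρ (smoothWindow c ρ))
    {κ c Y s t : ℝ} (hs : s ∈ Ioo α β) (ht : t ∈ Ioo α β)
    (hsx : x s ∈ Ioo l r) (htx : x t ∈ Ioo l r)
    (hsj : IsUniformJump u x κ c s) (htj : IsUniformJump u x κ c t) (hst : |x t - x s| < κ)
    (hYs : Y ∈ Ioo (x s - κ) (x s)) (hYt : Y ∈ Ioo (x t - κ) (x t))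
    (hY : |u (Y, t) - u (Y, s)| ≤ c / 4) :
    c * |x t - x s| ≤ 11 * (G * nonlocalModulus δ w D (|x t - x s| / 8)) * |t - s| := by
  wlog hlt : x s < x t generalizing s t
  · rcases (not_lt.1 hlt).eq_or_lt with h | h
    · have := nonlocalModulus_nonneg (D := D) (ρ := |x t - x s| / 8) hw hD (by positivity)
      have h0 : c * |x t - x s| = 0 := by simp [h]
      rw [h0]
      positivity
    · have := this ht hs htx hsx htj hsj (by rwa [abs_sub_comm]) hYt hYs (by rwa [abs_sub_comm]) h
      rwa [abs_sub_comm (x s), abs_sub_comm s] at this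
  rw [abs_of_pos (sub_pos.2 hlt)] at *
  -- The window lies well inside `(x s, x t)`, so `u` is continuous on it at both times.
  set ρ := (x t - x s) / 8 with hρdef
  set m := (x s + x t) / 2 with hm
  have hρ : 0 < ρ := by rw [hρdef]; linarith
  have ha := hwin m ρ hρ
  set a := smoothWindow m ρ
  set L := G * nonlocalModulus δ w D ρ
  have hmass : |(∫ y, a y * u (y, t)) - ∫ y, a y * u (y, s)| ≤ L * |t - s| := by
    have hl : l < m - 2 * ρ := by rw [hm, hρdef]; linarith [hsx.1]
    have hr : m + 2 * ρ < r := by rw [hm, hρdef]; linarith [htx.2]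
    rcases lt_trichotomy s t with h | h | h
    · rw [abs_of_pos (sub_pos.2 h)]
      exact hu.abs_mass_sub_le hδ hw hM hG hα hβ hc hD hρ ha hl hr hs ht h
    · exact absurd hlt (by rw [h]; exact lt_irrefl _)
    · rw [abs_sub_comm, abs_sub_comm t, abs_of_pos (sub_pos.2 h)]
      exact hu.abs_mass_sub_le hδ hw hM hG hα hβ hc hD hρ ha hl hr ht hs h
  have hwsub : Icc (m - 2 * ρ) (m + 2 * ρ) ⊆ Ioo (x s) (x t) := fun y hy =>
    ⟨by rw [hm, hρdef] at hy; linarith [hy.1], by rw [hm, hρdef] at hy; linarith [hy.2]⟩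
  have hint : ∀ τ ∈ Ioo α β, x τ ∉ Ioo (x s) (x t) → Integrable fun y => a y * u (y, τ) := by
    intro τ hτ hxτ
    have hsupp : Function.support (fun y => a y * u (y, τ)) ⊆ Icc (m - 2 * ρ) (m + 2 * ρ) := by
      intro y hy
      by_contra hy'
      exact hy (by simp [ha.eq_zero y hy'])
    rw [← integrableOn_iff_integrable_of_support_subset hsupp]
    refine ContinuousOn.integrableOn_Icc fun y hy => ?_
    have hy' := hwsub hy
    refine ((contDiff_smoothWindow m ρ).continuous.continuousAt.mul ?_).continuousWithinAt
    exact (hc y ⟨hsx.1.trans hy'.1, hy'.2.trans htx.2⟩ τ hτ fun h => hxτ (h ▸ hy')).comp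
      (f := fun y => (y, τ)) (by fun_prop)
  have hit := hint t ht fun h => lt_irrefl _ h.2
  have his := hint s hs fun h => lt_irrefl _ h.1
  have hmI : m ∈ Ioo (x s) (x t) := ⟨by rw [hm]; linarith, by rw [hm]; linarith⟩
  have hright : ∀ y ∈ Ioo (x s) (x t), y ∈ Ioo (x s) (x s + κ) := fun y hy =>
    ⟨hy.1, by linarith [hy.2]⟩
  have hleft : ∀ y ∈ Ioo (x s) (x t), y ∈ Ioo (x t - κ) (x t) := fun y hy =>
    ⟨by linarith [hy.1], hy.2⟩
  have hκ : 0 < κ := by linarith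
  have hZ : x t + κ / 2 ∈ Ioo (x t) (x t + κ) := ⟨by linarith, by linarith⟩
  -- For `y` in `(x s, x t)`, `u (y, s)` is a right value and `u (y, t)` a left value.
  set V := u (m, t) - u (m, s) with hV
  have hosc : ∀ y ∈ Ioo (x s) (x t), |u (y, t) - u (y, s) - V| ≤ c / 4 := by
    intro y hy
    have h1 := abs_le.1 (hsj Y hYs Y hYs y (hright y hy) m (hright m hmI)).2.1
    have h2 := abs_le.1 (htj y (hleft y hy) m (hleft m hmI) _ hZ _ hZ).1
    exact abs_le.2 ⟨by linarith, by linarith⟩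
  have hVc : 5 * c / 8 ≤ |V| := by
    have h1 := (hsj Y hYs Y hYs m (hright m hmI) m (hright m hmI)).2.2
    have h2 := abs_le.1 (htj m (hleft m hmI) Y hYt _ hZ _ hZ).1
    have h3 := abs_le.1 hY
    rcases le_abs.1 h1 with h | h
    · exact le_abs.2 (Or.inr (by linarith))
    · exact le_abs.2 (Or.inl (by linarith))
  have hai : Integrable a := integrable_smoothWindow hρ
  have hmean : |(∫ y, a y * u (y, t)) - (∫ y, a y * u (y, s)) - V * ∫ y, a y|
      ≤ c / 4 * ∫ y, a y := by
    have hsub : Integrable fun y => a y * u (y, t) - a y * u (y, s) := hit.sub his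
    rw [← integral_sub hit his, ← integral_const_mul, ← integral_sub hsub
      (hai.const_mul V), ← integral_const_mul, ← Real.norm_eq_abs]
    refine norm_integral_le_of_norm_le (hai.const_mul _) (Eventually.of_forall fun y => ?_)
    by_cases hy : y ∈ Icc (m - 2 * ρ) (m + 2 * ρ)
    · have : a y * u (y, t) - a y * u (y, s) - V * a y = (u (y, t) - u (y, s) - V) * a y := by
        ring
      rw [this, norm_mul, Real.norm_of_nonneg (ha.nonneg y)]
      exact mul_le_mul_of_nonneg_right (hosc y (hwsub hy)) (ha.nonneg y)
    · simp [ha.eq_zero y hy]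
  have hA : 2 * ρ ≤ ∫ y, a y := two_mul_le_integral_smoothWindow hρ
  set A := ∫ y, a y
  have hA0 : 0 ≤ A := by linarith
  have hVA : |V| * A ≤ L * |t - s| + c / 4 * A := by
    have h1 : |V| * A = |V * A| := by rw [abs_mul, abs_of_nonneg hA0]
    rw [h1]
    have h2 := abs_le.1 hmass
    have h3 := abs_le.1 hmean
    exact abs_le.2 ⟨by linarith, by linarith⟩
  have h1 : 5 * c / 8 * A ≤ |V| * A := mul_le_mul_of_nonneg_right hVc hA0
  have hc0 : 0 ≤ c := by
    have := (abs_nonneg _).trans hY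
    linarith
  have h2 : c * (2 * ρ) ≤ c * A := mul_le_mul_of_nonneg_left hA hc0
  have h3 : c * (2 * ρ) = c * (x t - x s) / 4 := by rw [hρdef]; ring
  have h4 : 0 ≤ c * (x t - x s) := mul_nonneg hc0 (by linarith)
  have h5 : 0 ≤ L * |t - s| := (abs_nonneg _).trans hmass
  linarith

/-! ### Stationarity -/

theorem IsRectifiableCurve.continuousOn_fst {x : ℝ → ℝ} {I : Set ℝ} (hx : IsRectifiableCurve x I) :
    ContinuousOn x I :=
  continuous_fst.comp_continuousOn hx.continuousOn

/-- Around a point of the curve, `u` is continuous off the curve in a box which the curve leaves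
only through the top and the bottom. -/
theorem HasIsolatedDiscontinuityAlong.exists_box {u : ℝ × ℝ → ℝ} {x : ℝ → ℝ} {I : Set ℝ}
    (hux : HasIsolatedDiscontinuityAlong u x I) (hx : ContinuousOn x I) {t₀ : ℝ}
    (ht₀ : t₀ ∈ interior I) :
    ∃ r > 0, ∃ η > 0, Ioo (t₀ - η) (t₀ + η) ⊆ interior I ∧
      (∀ t ∈ Ioo (t₀ - η) (t₀ + η), |x t - x t₀| < r / 2) ∧
      ∀ y ∈ Ioo (x t₀ - r) (x t₀ + r), ∀ t ∈ Ioo (t₀ - η) (t₀ + η), y ≠ x t →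
        ContinuousAt u (y, t) := by
  have hxc : ∀ t ∈ interior I, ContinuousAt x t := fun t ht =>
    hx.continuousAt (mem_interior_iff_mem_nhds.1 ht)
  obtain ⟨U, hU, hUu⟩ := hux.contDiffOn_off_curve t₀ ht₀
  obtain ⟨r, hr, hrU⟩ := Metric.mem_nhds_iff.1 hU
  have h1 : ∀ᶠ t in 𝓝 t₀, |t - t₀| < r ∧ t ∈ interior I ∧ |x t - x t₀| < r / 2 :=
    Eventually.and (Metric.ball_mem_nhds t₀ hr) (Eventually.and (isOpen_interior.mem_nhds ht₀)
      (Metric.tendsto_nhds.1 (hxc t₀ ht₀) (r / 2) (by positivity)))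
  obtain ⟨η, hη, hη'⟩ := Metric.mem_nhds_iff.1 h1
  rw [Real.ball_eq_Ioo] at hη'
  refine ⟨r, hr, η, hη, fun t ht => (hη' ht).2.1, fun t ht => (hη' ht).2.2,
    fun y hy t ht hne => ?_⟩
  have hUnhds : U ∈ 𝓝 (y, t) := by
    refine mem_of_superset (Metric.isOpen_ball.mem_nhds ?_) hrU
    rw [← Real.ball_eq_Ioo] at hy
    exact max_lt hy (hη' ht).1
  have hoff : ∀ᶠ q : ℝ × ℝ in 𝓝 (y, t), q.1 ≠ x q.2 := by
    have hc : ContinuousAt (fun q : ℝ × ℝ => x q.2) (y, t) :=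
      ContinuousAt.comp (f := Prod.snd) (g := x) (hxc t (hη' ht).2.1) continuousAt_snd
    filter_upwards [(continuousAt_fst.sub hc).eventually_ne (sub_ne_zero.2 hne)] with q hq
    exact sub_ne_zero.1 hq
  have hmem : U \ spaceTimeCurve x I ∈ 𝓝 (y, t) := by
    filter_upwards [hUnhds, hoff] with q hq hq'
    refine ⟨hq, ?_⟩
    rintro ⟨s, -, rfl⟩
    exact hq' rfl
  exact hUu.continuousOn.continuousAt hmem

/-- No interior time is a moving time: otherwise, by the Baire category theorem, the jumps are
uniform on a portion of the moving times, and the curve has zero speed there. -/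
theorem notMem_movingTimes_of_isWeakSolution {δ T : ℝ} (hδ : 0 < δ)
    {w : ℝ → ℝ} (hw : IsInteractionKernel δ w) {f : ℝ → ℝ} {g : ℝ → ℝ → ℝ}
    (hg : IsMonotoneFlux f g) {u₀ : ℝ → ℝ} {u : ℝ × ℝ → ℝ} (hu : IsWeakSolution δ T w g u₀ u)
    {I : Set ℝ} (hIT : I ⊆ Icc 0 T) {x : ℝ → ℝ} (hx : ContinuousOn x I)
    (hux : HasIsolatedDiscontinuityAlong u x I) {t₀ : ℝ} (ht₀ : t₀ ∈ interior I) :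
    t₀ ∉ movingTimes x := by
  intro ht₀K
  obtain ⟨M, hM⟩ := exists_ae_abs_le hu.memLp_top
  obtain ⟨G, hG0, hG⟩ := hg.exists_bound M
  obtain ⟨D, hD, hwin⟩ := exists_isWindow_smoothWindow
  have hxc : ∀ t ∈ interior I, ContinuousAt x t := fun t ht =>
    hx.continuousAt (mem_interior_iff_mem_nhds.1 ht)
  obtain ⟨r, hr, η, hη, hηI, hηx, hbox⟩ := hux.exists_box hx ht₀
  have hκ : ∀ k : ℕ, 0 < r / 2 / ((k : ℝ) + 1) ∧ r / 2 / ((k : ℝ) + 1) ≤ r / 2 := fun k =>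
    ⟨by positivity, div_le_self (by positivity) (by linarith [(Nat.cast_nonneg k : (0 : ℝ) ≤ k)])⟩
  set S := movingTimes x ∩ Ioo (t₀ - η) (t₀ + η) with hS
  have ht₀S : t₀ ∈ S := ⟨ht₀K, by linarith, by linarith⟩
  have hSl : IsLocallyClosed S :=
    (isClosed_movingTimes x).isLocallyClosed.inter isOpen_Ioo.isLocallyClosed
  have := hSl.locallyCompactSpace
  have : Nonempty S := ⟨⟨t₀, ht₀S⟩⟩
  obtain ⟨⟨n, k⟩, tm, htm⟩ := nonempty_interior_of_iUnion_of_closed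
    (f := fun i : ℕ × ℕ =>
      {s : S | IsUniformJump u x (r / 2 / ((i.2 : ℝ) + 1)) (1 / ((i.1 : ℝ) + 1)) s})
    (fun i => isClosed_isUniformJump (fun s hs => hxc s (hηI hs.2)) fun s hs y hy hne =>
      hbox y (by
        have h1 := abs_lt.1 (hηx s hs.2)
        have h2 := (hκ i.2).2
        exact ⟨by linarith [hy.1], by linarith [hy.2]⟩) s hs.2 hne)
    (by
      refine eq_univ_of_forall fun s => mem_iUnion.2 ?_
      obtain ⟨uL, uR, hL, hR, hne⟩ := hux.jump s (hηI s.2.2)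
      obtain ⟨n, k, h⟩ := exists_isUniformJump (half_pos hr) hL hR hne
      exact ⟨(n, k), h⟩)
  dsimp only at htm
  obtain ⟨hκ0, hκr⟩ := hκ k
  set κ := r / 2 / ((k : ℝ) + 1)
  set c : ℝ := 1 / ((n : ℝ) + 1)
  have hc : 0 < c := Nat.one_div_pos_of_nat
  have hunif : ∀ᶠ s in 𝓝 (tm : ℝ), s ∈ movingTimes x → IsUniformJump u x κ c s := by
    have h1 : {s : S | IsUniformJump u x κ c s} ∈ 𝓝 tm := mem_interior_iff_mem_nhds.1 htm
    rw [nhds_subtype_eq_comap, mem_comap] at h1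
    obtain ⟨V, hV, hVs⟩ := h1
    filter_upwards [hV, Ioo_mem_nhds tm.2.2.1 tm.2.2.2] with s hs hsI hsK
    exact hVs (a := ⟨s, hsK, hsI⟩) hs
  -- `Y` lies in the left strip of the curve for all times near `tm`. Comparing the left values of
  -- `u` at two such times through `u (Y, ·)` needs no continuity of the one-sided limits.
  set Y := x tm - κ / 2 with hYdef
  have hxm := abs_lt.1 (hηx tm tm.2.2)
  have hYbox : Y ∈ Ioo (x t₀ - r) (x t₀ + r) := ⟨by linarith, by linarith⟩
  have hYc : ContinuousAt (fun t => u (Y, t)) (tm : ℝ) :=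
    (hbox Y hYbox tm tm.2.2 (by rw [hYdef]; linarith)).comp (f := fun t => (Y, t)) (by fun_prop)
  have hev : ∀ᶠ s in 𝓝 (tm : ℝ), s ∈ Ioo (t₀ - η) (t₀ + η) ∧
      (s ∈ movingTimes x → IsUniformJump u x κ c s) ∧ |x s - x tm| < κ / 4 ∧
      |u (Y, s) - u (Y, tm)| < c / 8 :=
    Eventually.and (Ioo_mem_nhds tm.2.2.1 tm.2.2.2) (hunif.and
      ((Metric.tendsto_nhds.1 (hxc tm (hηI tm.2.2)) (κ / 4) (by positivity)).and
        (Metric.tendsto_nhds.1 hYc (c / 8) (by positivity))))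
  obtain ⟨ζ, hζ, hζ'⟩ := Metric.mem_nhds_iff.1 hev
  rw [Real.ball_eq_Ioo] at hζ'
  set J := Ioo ((tm : ℝ) - ζ) (tm + ζ) with hJ
  have hIoo : Ioo (t₀ - η) (t₀ + η) ⊆ Ioo 0 T :=
    hηI.trans ((interior_mono hIT).trans interior_Icc.subset)
  have hαβ : t₀ - η < t₀ + η := by linarith
  obtain ⟨hα, hβ⟩ := (Ioo_subset_Ioo_iff hαβ).1 hIoo
  have hdisp : ∀ s ∈ movingTimes x ∩ J, ∀ t ∈ movingTimes x ∩ J, |x t - x s| ≤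
      (fun d => 11 / c * (G * nonlocalModulus δ w D (d / 8))) |x t - x s| * |t - s| := by
    intro s hs t ht
    obtain ⟨hsI, hsu, hsx, hsY⟩ := hζ' hs.2
    obtain ⟨htI, htu, htx, htY⟩ := hζ' ht.2
    rw [abs_lt] at hsx htx hsY htY
    have hsb := abs_lt.1 (hηx s hsI)
    have htb := abs_lt.1 (hηx t htI)
    have h1 := hu.displacement_le hδ hw hM hG0 hG hα hβ hbox hD hwin hsI htI
      ⟨by linarith, by linarith⟩ ⟨by linarith, by linarith⟩ (hsu hs.1) (htu ht.1)
      (abs_lt.2 ⟨by linarith, by linarith⟩) (Y := Y) ⟨by linarith, by linarith⟩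
      ⟨by linarith, by linarith⟩ (abs_le.2 ⟨by linarith, by linarith⟩)
    dsimp only
    rw [mul_comm, ← le_div_iff₀ hc] at h1
    refine h1.trans (le_of_eq ?_)
    ring
  have hN : Tendsto (fun d => 11 / c * (G * nonlocalModulus δ w D (d / 8))) (𝓝[≥] 0) (𝓝 0) := by
    have h8 : Tendsto (fun d : ℝ => d / 8) (𝓝[≥] 0) (𝓝[≥] 0) := by
      refine tendsto_nhdsWithin_iff.2 ⟨?_, ?_⟩
      · have : Continuous fun d : ℝ => d / 8 := by fun_prop
        simpa using (this.tendsto 0).mono_left nhdsWithin_le_nhds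
      · filter_upwards [self_mem_nhdsWithin] with d hd
        exact div_nonneg (mem_Ici.1 hd) (by norm_num)
    simpa using (((tendsto_nonlocalModulus hδ hw hD).comp h8).const_mul G).const_mul (11 / c)
  have hxJ : ContinuousOn x J := fun t ht =>
    (hxc t (hηI (hζ' ht).1)).continuousWithinAt
  have hder : ∀ t ∈ J, HasDerivAt x 0 t := fun t ht =>
    hasDerivAt_zero_of_displacement hxJ hN hdisp ht
  have htmJ : (tm : ℝ) ∈ J := ⟨by linarith, by linarith⟩
  refine tm.2.1 ?_
  filter_upwards [isOpen_Ioo.mem_nhds htmJ] with s hs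
  have hsub : uIcc s tm ⊆ J := ordConnected_Ioo.uIcc_subset hs htmJ
  exact eq_of_hasDerivAt_zero (hxJ.mono hsub) fun q hq => hder q (hsub ⟨hq.1.le, hq.2.le⟩)

theorem mainTheorem3 (δ T : ℝ) (hδ : 0 < δ) (hT : 0 < T)
    (w : ℝ → ℝ) (hw : IsInteractionKernel δ w)
    (f : ℝ → ℝ) (g : ℝ → ℝ → ℝ) (hg : IsMonotoneFlux f g)
    (u₀ : ℝ → ℝ) (u : ℝ × ℝ → ℝ) (hu : IsWeakSolution δ T w g u₀ u)
    (I : Set ℝ) (hI : I.OrdConnected) (hIT : I ⊆ Icc 0 T)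
    (x : ℝ → ℝ) (hx : IsRectifiableCurve x I)
    (hux : HasIsolatedDiscontinuityAlong u x I) :
    (∀ t ∈ I, HasDerivWithinAt x 0 I t) ∧ (∀ s ∈ I, ∀ t ∈ I, x s = x t) := by
  have hxc := hx.continuousOn_fst
  have hconst : ∀ s ∈ I, ∀ t ∈ I, x s = x t := by
    intro s hs t ht
    have hsub : uIcc s t ⊆ I := hI.uIcc_subset hs ht
    refine eq_of_hasDerivAt_zero (hxc.mono hsub) fun r hr => ?_
    refine hasDerivAt_zero_of_notMem_movingTimes
      (notMem_movingTimes_of_isWeakSolution hδ hw hg hu hIT hxc hux ?_)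
    exact interior_maximal (fun q hq => hsub ⟨hq.1.le, hq.2.le⟩) isOpen_Ioo hr
  refine ⟨fun t ht => ?_, hconst⟩
  exact (hasDerivWithinAt_const t I (x t)).congr (fun s hs => hconst s hs t ht) rfl
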